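/- Let $\Upsilon(z)=e^z-z-1$. A continuous function $F:[0,\infty)\to[0,\infty)$ is called a CD-function if $F(0)=0$, $F(x)/x$ is strictly increasing on $(0,\infty)$, and $1/F$ is integrable at $\infty$. Its relaxation function is the strictly positive solution $\varphi:(0,\infty)\to(0,\infty)$ of $\dot\varphi(t)+F(\varphi(t))=0$, $t>0$, with $\varphi(0+)=\infty$. For $\mu_0>0$ put $$F_{\mu_0}(a)=\frac{2}{\mu_0^2}\,e^{-\mu_0 a/2}\,\big[\Upsilon(\mu_0 a)+\Upsilon(-\mu_0 a)\big],\qquad a\ge 0 .$$ Then $F_1$ is a CD-function which has a relaxation function $\varphi$. Let $\tau>0$ and, for $f:\tau\mathbb{Z}\to\mathbb{R}$, let $$\Delta_\tau f(x)=\frac{1}{\tau^2}\big(f(x+\tau)-2f(x)+f(x-\tau)\big),\qquad x\in\tau\mathbb{Z}.$$ Suppose that $u:[0,\infty)\times\tau\mathbb{Z}\to(0,\infty)$ solves the heat equation $\partial_t u-\Delta_\tau u=0$ on $[0,\infty)\times\tau\mathbb{Z}$. Then $$-\Delta_\tau(\log u)(t,x)\le \frac{1}{\tau^2}\,\varphi\Big(\frac{t}{\tau^2}\Big)\qquad\text{for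 all } t>0,\ x\in\tau\mathbb{Z},$$ and $t\mapsto \tau^{-2}\varphi(t/\tau^2)$ is the relaxation function of the CD-function $F_{\mu_0}$ with $\mu_0=\tau^2$. -/

import Mathlib

open Set Filter Topology MeasureTheory

noncomputable section

/-- A CD-function, i.e. a continuous `F : [0,∞) → [0,∞)` with `F 0 = 0`, with `F x / x` strictly
increasing on `(0,∞)`, and with `1 / F` integrable at infinity. `F` is represented by a function on
`ℝ` of which only the values on `[0,∞)` matter. -/
structure IsCDFunction (F : ℝ → ℝ) : Prop where
  continuousOn : ContinuousOn F (Ici 0)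
  nonneg : ∀ x, 0 ≤ x → 0 ≤ F x
  map_zero : F 0 = 0
  strictMonoOn : StrictMonoOn (fun x => F x / x) (Ioi 0)
  integrableAt_top : IntegrableOn (fun x => 1 / F x) (Ici 1)

/-- `φ` (restricted to `(0,∞)`) is the relaxation function of the CD-function `F`: the strictly
positive solution on `(0,∞)` of `φ' + F(φ) = 0` with `φ(0+) = ∞`. -/
structure IsRelaxationFunction (F φ : ℝ → ℝ) : Prop where
  isCDFunction : IsCDFunction F
  pos : ∀ t, 0 < t → 0 < φ t
  hasDerivAt : ∀ t, 0 < t → HasDerivAt φ (-F (φ t)) t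
  tendsto_zero : Tendsto φ (𝓝[>] 0) atTop

/-- `Υ(z) = e^z - z - 1`. -/
def Upsilon (z : ℝ) : ℝ := Real.exp z - z - 1

/-- The CD-function attached to `D`-regular unweighted Ricci-flat graphs (`D ≥ 2`) with constant
vertex measure `μ₀`. -/
def ricciFlatCD (D : ℕ) (μ₀ : ℝ) (a : ℝ) : ℝ :=
  (D / μ₀ ^ 2) * Real.exp (-(μ₀ / D) * a) *
    (Upsilon (2 * μ₀ / D * a) + (D - 1) * Upsilon (-(2 * μ₀ / (D * (D - 1))) * a))

/-- The grid `τℤ`, as a subgroup of `ℝ`. -/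
abbrev Grid (τ : ℝ) : Type := AddSubgroup.zmultiples τ

/-- The element `τ` of the grid `τℤ`. -/
def gridStep (τ : ℝ) : Grid τ := ⟨τ, AddSubgroup.mem_zmultiples τ⟩

/-- The Laplace operator `Δ_τ f(x) = (f(x + τ) - 2 f(x) + f(x - τ)) / τ²` on `τℤ`. -/
def gridLaplacian (τ : ℝ) (f : Grid τ → ℝ) (x : Grid τ) : ℝ :=
  1 / τ ^ 2 * (f (x + gridStep τ) - 2 * f x + f (x - gridStep τ))

/-- `u` solves `∂ₜ u - Δ_τ u = 0` on `[0,∞) × τℤ` (with the one-sided time derivative at `t = 0`).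
Only the values of `u` at times `t ≥ 0` matter. -/
def SolvesGridHeat (τ : ℝ) (u : ℝ → Grid τ → ℝ) : Prop :=
  ∀ t, 0 ≤ t → ∀ x : Grid τ,
    HasDerivWithinAt (fun s => u s x) (gridLaplacian τ (u t) x) (Ici 0) t

end

/-! After the substitution `z s k = exp (2 s) u(τ² s, x + kτ)` the heat equation becomes `z' = A z`
on ℤ, where `A` is the adjacency operator. Put `G = 2 log z(k) - log z(k+1) - log z(k-1)`; the claim
is `G ≤ φ`. Where `G` is spatially maximal, comparison with both neighbours gives `∂ₜ G ≤ -F₁(G)`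
(`second_log_deriv_le`). For spatially periodic `z` the maximum is attained, and a first-touching
argument against `lam * φ`, `lam > 1`, proves the bound (`liYau_periodic_lt`).

Arbitrary positive solutions are reached by approximating the initial data. Since `A` preserves
positivity, every time derivative of `z` is nonnegative, so Bernstein's theorem gives `z t = exp
(tA) (z 0)` with no growth assumption. The bound, written as `z(k)² ≤ exp φ · z(k+1) z(k-1)`, then
passes from periodic to bounded to general data by dominated convergence. -/

/-! ### The CD-function for `D = 2` and its scaling. -/

theorem ricciFlatCD_two {μ : ℝ} (a : ℝ) :
    ricciFlatCD 2 μ a = 2 / μ ^ 2 * (Real.exp (μ * a / 2) * (1 - Real.exp (-(μ * a))) ^ 2) := by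
  have e1 : Real.exp (-(μ / 2) * a) = (Real.exp (μ * a / 2))⁻¹ := by
    rw [← Real.exp_neg]; congr 1; ring
  have e2 : Real.exp (μ * a) = Real.exp (μ * a / 2) ^ 2 := by
    rw [← Real.exp_nat_mul]; congr 1; push_cast; ring
  have e3 : 2 * μ / 2 * a = μ * a := by ring
  have e4 : -(2 * μ / (2 * (2 - 1))) * a = -(μ * a) := by ring
  unfold ricciFlatCD Upsilon
  push_cast
  rw [e1, e3, e4, Real.exp_neg, e2]
  have := Real.exp_pos (μ * a / 2)
  generalize Real.exp (μ * a / 2) = y at *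
  field_simp
  ring

theorem ricciFlatCD_two_scale {μ : ℝ} (a : ℝ) :
    ricciFlatCD 2 μ a = ricciFlatCD 2 1 (μ * a) / μ ^ 2 := by
  simp only [ricciFlatCD_two, one_mul, one_pow]; ring

theorem ricciFlatCD_two_one (a : ℝ) : ricciFlatCD 2 1 a =
    2 * (Real.exp (a / 2) - 2 * Real.exp (-(a / 2)) + Real.exp (-(3 * a / 2))) := by
  have e2 : Real.exp a = Real.exp (a / 2) ^ 2 := by
    rw [← Real.exp_nat_mul]; congr 1; push_cast; ring
  have e3 : Real.exp (3 * a / 2) = Real.exp (a / 2) ^ 3 := by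
    rw [← Real.exp_nat_mul]; congr 1; push_cast; ring
  rw [ricciFlatCD_two, one_mul]
  simp only [Real.exp_neg]
  rw [e2, e3]
  have := Real.exp_pos (a / 2)
  generalize Real.exp (a / 2) = y at *
  field_simp
  ring

/-- Since the function vanishes at 0, `F x / x` is a secant slope, so strict convexity makes it
strictly increasing. -/
theorem strictConvexOn_ricciFlatCD_two_one : StrictConvexOn ℝ univ (ricciFlatCD 2 1) := by
  have hd : ∀ (c a : ℝ), HasDerivAt (fun a => Real.exp (c * a)) (c * Real.exp (c * a)) a := by
    intro c a
    simpa [mul_comm] using ((hasDerivAt_id a).const_mul c).exp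
  have h0 : ricciFlatCD 2 1 = fun a => 2 * (Real.exp ((1 / 2) * a) -
      2 * Real.exp ((-1 / 2) * a) + Real.exp ((-3 / 2) * a)) := by
    funext a
    rw [ricciFlatCD_two_one, show (1 / 2) * a = a / 2 by ring, show (-1 / 2) * a = -(a / 2) by ring,
      show (-3 / 2) * a = -(3 * a / 2) by ring]
  have h1 : deriv (ricciFlatCD 2 1) = fun a => 2 * ((1 / 2) * Real.exp ((1 / 2) * a) -
      2 * ((-1 / 2) * Real.exp ((-1 / 2) * a)) + (-3 / 2) * Real.exp ((-3 / 2) * a)) := by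
    funext a
    rw [h0]
    exact ((((hd _ a).sub ((hd _ a).const_mul 2)).add (hd _ a)).const_mul 2).deriv
  have h2 : deriv (deriv (ricciFlatCD 2 1)) = fun a => 2 * ((1 / 2) * ((1 / 2) *
      Real.exp ((1 / 2) * a)) - 2 * ((-1 / 2) * ((-1 / 2) * Real.exp ((-1 / 2) * a))) +
      (-3 / 2) * ((-3 / 2) * Real.exp ((-3 / 2) * a))) := by
    funext a
    rw [h1]
    exact (((((hd _ a).const_mul _).sub (((hd _ a).const_mul _).const_mul 2)).add
      ((hd _ a).const_mul _)).const_mul 2).deriv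
  refine strictConvexOn_of_deriv2_pos convex_univ ?_ ?_
  · rw [h0]; fun_prop
  · intro a _
    simp only [Function.iterate_succ, Function.iterate_zero, Function.comp, id, h2]
    have e1 : Real.exp ((-1 / 2) * a) = Real.exp ((1 / 2) * a) * Real.exp (-a) := by
      rw [← Real.exp_add]; congr 1; ring
    have e2 : Real.exp ((-3 / 2) * a) = Real.exp ((1 / 2) * a) * Real.exp (-a) ^ 2 := by
      rw [← Real.exp_nat_mul, ← Real.exp_add]; congr 1; push_cast; ring
    rw [e1, e2]
    have := Real.exp_pos ((1 / 2) * a)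
    generalize Real.exp (-a) = z
    -- With `z = exp (-a)`, the second derivative is `exp (a/2) (1 - 2z + 9z²) / 2`.
    nlinarith [mul_pos this (show 0 < (1 : ℝ) - 2 * z + 9 * z ^ 2 by nlinarith [sq_nonneg (z - 1 / 9)])]

theorem isCDFunction_ricciFlatCD_two {μ : ℝ} (hμ : 0 < μ) : IsCDFunction (ricciFlatCD 2 μ) := by
  have hcont : Continuous (ricciFlatCD 2 μ) := by
    rw [show ricciFlatCD 2 μ = _ from funext ricciFlatCD_two]
    fun_prop
  have hzero : ∀ ν, ricciFlatCD 2 ν 0 = 0 := fun ν => by simp [ricciFlatCD_two]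
  refine ⟨hcont.continuousOn, fun x _ => ?_, hzero μ, ?_, ?_⟩
  · rw [ricciFlatCD_two]; positivity
  · intro x hx y hy hxy
    have hx : 0 < x := hx
    have hy : 0 < y := hy
    have := strictConvexOn_ricciFlatCD_two_one.secant_strict_mono (mem_univ 0) (mem_univ (μ * x))
      (mem_univ (μ * y)) (by positivity) (by positivity) (by gcongr)
    rw [hzero, sub_zero, sub_zero, sub_zero, sub_zero] at this
    have e : ∀ x, ricciFlatCD 2 μ x / x = ricciFlatCD 2 1 (μ * x) / (μ * x) / μ := by
      intro x; rw [ricciFlatCD_two_scale]; field_simp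
    simp only [e]
    gcongr
  · have hpos : 0 < 1 - Real.exp (-μ) := by
      have : Real.exp (-μ) < 1 := by simpa using hμ
      linarith
    -- On `[1, ∞)` the factor `1 - exp (-μx)` is at least its value at 1, so `F` grows at least like
    -- `exp (μx/2)`.
    have hg : IntegrableOn (fun x => (2 / μ ^ 2 * (1 - Real.exp (-μ)) ^ 2)⁻¹ *
        Real.exp (-(μ / 2) * x)) (Ici 1) := by
      rw [integrableOn_Ici_iff_integrableOn_Ioi]
      exact (integrableOn_exp_mul_Ioi (by linarith) 1).const_mul _
    refine hg.mono' ?_ ?_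
    · exact (measurable_const.div hcont.measurable).aestronglyMeasurable
    · refine (ae_restrict_iff' measurableSet_Ici).2 (ae_of_all _ fun x hx => ?_)
      have hx : 1 ≤ x := hx
      have h1 : 1 - Real.exp (-μ) ≤ 1 - Real.exp (-(μ * x)) := by
        have : Real.exp (-(μ * x)) ≤ Real.exp (-μ) := Real.exp_le_exp.2 (by nlinarith)
        linarith
      have h2 : Real.exp (-(μ / 2) * x) = (Real.exp (μ * x / 2))⁻¹ := by
        rw [← Real.exp_neg]; congr 1; ring
      rw [ricciFlatCD_two, h2, ← mul_inv, Real.norm_of_nonneg (by positivity), one_div]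
      refine inv_anti₀ (by positivity) ?_
      calc 2 / μ ^ 2 * (1 - Real.exp (-μ)) ^ 2 * Real.exp (μ * x / 2)
          = 2 / μ ^ 2 * (Real.exp (μ * x / 2) * (1 - Real.exp (-μ)) ^ 2) := by ring
        _ ≤ _ := by gcongr

theorem IsRelaxationFunction.rescale {φ : ℝ → ℝ} (h : IsRelaxationFunction (ricciFlatCD 2 1) φ)
    {μ : ℝ} (hμ : 0 < μ) :
    IsRelaxationFunction (ricciFlatCD 2 μ) (fun t => 1 / μ * φ (t / μ)) := by
  refine ⟨isCDFunction_ricciFlatCD_two hμ, fun t ht => ?_, fun t ht => ?_, ?_⟩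
  · exact mul_pos (by positivity) (h.pos _ (by positivity))
  · have := ((h.hasDerivAt (t / μ) (by positivity)).comp t
      ((hasDerivAt_id t).div_const μ)).const_mul (1 / μ)
    refine this.congr_deriv ?_
    rw [ricciFlatCD_two_scale (μ := μ), show μ * (1 / μ * φ (t / μ)) = φ (t / μ) by field_simp]
    field_simp
  · refine Tendsto.const_mul_atTop (by positivity) (h.tendsto_zero.comp ?_)
    refine tendsto_nhdsWithin_iff.2 ⟨?_, ?_⟩
    · have : Tendsto (fun t : ℝ => t / μ) (𝓝 0) (𝓝 (0 / μ)) := tendsto_id.div_const μ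
      rw [zero_div] at this
      exact this.mono_left nhdsWithin_le_nhds
    · filter_upwards [self_mem_nhdsWithin] with t ht
      exact div_pos ht hμ

/-! ### Existence of the relaxation function. -/

/-- Separation of variables with `φ = 2 log coth (q/2)` turns the equation into `dt/dq = (cosh q +
1)/4`, so `t = (sinh q + q)/4`, which is inverted as an order isomorphism of ℝ. -/
theorem exists_isRelaxationFunction : ∃ φ, IsRelaxationFunction (ricciFlatCD 2 1) φ := by
  set T : ℝ → ℝ := fun q => (Real.sinh q + q) / 4 with hT
  have hTd : ∀ q, HasDerivAt T ((Real.cosh q + 1) / 4) q := fun q =>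
    ((Real.hasDerivAt_sinh q).add (hasDerivAt_id q)).div_const 4
  have hTm : StrictMono T := fun a b hab => by
    have := Real.sinh_lt_sinh.2 hab
    simp only [hT]; linarith
  have hTc : Continuous T := continuous_iff_continuousAt.2 fun q => (hTd q).continuousAt
  have hTs : Function.Surjective T := by
    refine hTc.surjective ?_ ?_
    · refine tendsto_atTop_mono' _ ?_ (tendsto_id.atTop_div_const (by norm_num : (0 : ℝ) < 4))
      filter_upwards [eventually_ge_atTop 0] with q hq
      have := Real.sinh_nonneg_iff.2 hq
      simp only [hT, id]; linarith
    · refine tendsto_atBot_mono' _ ?_ (tendsto_id.atBot_div_const (by norm_num : (0 : ℝ) < 4))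
      filter_upwards [eventually_le_atBot 0] with q hq
      have := Real.sinh_nonpos_iff.2 hq
      simp only [hT, id]; linarith
  set e := hTm.orderIsoOfSurjective T hTs
  have heT : ∀ t, T (e.symm t) = t := fun t => e.apply_symm_apply t
  have hT0 : T 0 = 0 := by simp [hT]
  have he0 : e.symm 0 = 0 := e.symm_apply_eq.2 hT0.symm
  have hepos : ∀ t, 0 < t → 0 < e.symm t := fun t ht => by
    rw [← he0]; exact e.symm.strictMono ht
  have hed : ∀ t, HasDerivAt e.symm ((Real.cosh (e.symm t) + 1) / 4)⁻¹ t := fun t =>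
    (hTd (e.symm t)).of_local_left_inverse e.symm.continuous.continuousAt
      (by have := Real.cosh_pos (e.symm t); positivity) (Eventually.of_forall heT)
  refine ⟨fun t => 2 * (Real.log (Real.cosh (e.symm t / 2)) - Real.log (Real.sinh (e.symm t / 2))),
    isCDFunction_ricciFlatCD_two one_pos, fun t ht => ?_, fun t ht => ?_, ?_⟩
  · have hs : 0 < Real.sinh (e.symm t / 2) := Real.sinh_pos_iff.2 (half_pos (hepos t ht))
    have := Real.log_lt_log hs (Real.sinh_lt_cosh _)
    linarith
  · have hs : 0 < Real.sinh (e.symm t / 2) := Real.sinh_pos_iff.2 (half_pos (hepos t ht))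
    have hc : 0 < Real.cosh (e.symm t / 2) := Real.cosh_pos _
    have hq := (hed t).div_const 2
    refine ((((hq.cosh).log hc.ne').sub ((hq.sinh).log hs.ne')).const_mul 2).congr_deriv ?_
    have h1 : Real.cosh (e.symm t) + 1 = 2 * Real.cosh (e.symm t / 2) ^ 2 := by
      have := Real.cosh_two_mul (e.symm t / 2)
      have h2 := Real.cosh_sq (e.symm t / 2)
      rw [mul_div_cancel₀ _ (two_ne_zero)] at this
      linarith
    simp only [ricciFlatCD_two, one_mul]
    rw [h1, mul_div_cancel_left₀ _ (two_ne_zero),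
      ← Real.log_div hc.ne' hs.ne', Real.exp_neg, two_mul (Real.log _), Real.exp_add,
      Real.exp_log (by positivity)]
    have h2 := Real.cosh_sq (e.symm t / 2)
    generalize Real.cosh (e.symm t / 2) = c at *
    generalize Real.sinh (e.symm t / 2) = s at *
    have h3 : c ^ 2 - s ^ 2 = 1 := by linarith
    have l1 : 2 * (s * ((2 * c ^ 2 / 4)⁻¹ / 2) / c - c * ((2 * c ^ 2 / 4)⁻¹ / 2) / s)
      = - (2 * (c ^ 2 - s ^ 2) / (s * c ^ 3)) := by field_simp; ring
    have l2 : 2 / 1 ^ 2 * (c / s * (1 - (c / s * (c / s))⁻¹) ^ 2)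
      = 2 * (c ^ 2 - s ^ 2) ^ 2 / (s * c ^ 3) := by field_simp
    rw [l1, l2, h3]; simp
  · have hs : Tendsto (fun t => Real.sinh (e.symm t / 2)) (𝓝[>] 0) (𝓝[>] 0) := by
      refine tendsto_nhdsWithin_iff.2 ⟨?_, ?_⟩
      · have : Continuous fun t => Real.sinh (e.symm t / 2) :=
          Real.continuous_sinh.comp (e.symm.continuous.div_const 2)
        have := this.tendsto 0
        simp only [he0, zero_div, Real.sinh_zero] at this
        exact this.mono_left nhdsWithin_le_nhds
      · filter_upwards [self_mem_nhdsWithin] with t ht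
        exact Real.sinh_pos_iff.2 (half_pos (hepos t ht))
    have hl := tendsto_neg_atBot_atTop.comp (Real.tendsto_log_nhdsGT_zero.comp hs)
    refine Tendsto.const_mul_atTop two_pos (tendsto_atTop_mono (fun t => ?_) hl)
    have := Real.log_nonneg (Real.one_le_cosh (e.symm t / 2))
    simp only [Function.comp]
    linarith

/-! ### Bernstein's theorem and the power series flow on ℤ. -/

/-- Bernstein's theorem: a function on `[0,∞)` with nonnegative derivatives of all orders is the
sum of its Taylor series. -/
theorem hasSum_taylor_of_nonneg {D : ℕ → ℝ → ℝ} (hD : ∀ n t, 0 ≤ t → 0 ≤ D n t)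
    (hd : ∀ n t, 0 ≤ t → HasDerivWithinAt (D n) (D (n + 1) t) (Ici 0) t) {t : ℝ} (ht : 0 ≤ t) :
    HasSum (fun n => t ^ n / n.factorial * D n 0) (D 0 t) := by
  -- Taylor remainder of order `n` of the `m`-th derivative. Differentiation lowers `n` and raises
  -- `m`, so the inductions on `n` below integrate from 0.
  set R : ℕ → ℕ → ℝ → ℝ := fun n m t =>
    D m t - ∑ j ∈ Finset.range n, t ^ j / j.factorial * D (m + j) 0 with hR
  have hR0 : ∀ n m, R (n + 1) m 0 = 0 := fun n m => by
    simp [hR, Finset.sum_range_succ']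
  have hRd : ∀ n m t, 0 ≤ t → HasDerivWithinAt (R (n + 1) m) (R n (m + 1) t) (Ici 0) t := by
    intro n m t ht
    refine (hd m t ht).sub ?_
    have : ∀ j ∈ Finset.range n, HasDerivWithinAt
        (fun t : ℝ => t ^ (j + 1) / (j + 1).factorial * D (m + (j + 1)) 0)
        (t ^ j / j.factorial * D (m + 1 + j) 0) (Ici 0) t := by
      intro j _
      refine (((hasDerivAt_pow (j + 1) t).div_const _).mul_const _).hasDerivWithinAt.congr_deriv ?_
      rw [Nat.factorial_succ, show m + (j + 1) = m + 1 + j by ring]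
      push_cast
      have : (j.factorial : ℝ) ≠ 0 := by positivity
      field_simp
    have h2 := HasDerivWithinAt.fun_sum this
    refine (h2.add_const (D m 0)).congr_of_mem (fun s _ => ?_) ht
    simp [Finset.sum_range_succ']
  have mono : ∀ f f' : ℝ → ℝ, (∀ t, 0 ≤ t → HasDerivWithinAt f (f' t) (Ici 0) t) →
      (∀ t, 0 ≤ t → 0 ≤ f' t) → MonotoneOn f (Ici 0) := by
    intro f f' h1 h2
    refine monotoneOn_of_hasDerivWithinAt_nonneg (convex_Ici 0)
      (fun t ht => (h1 t ht).continuousWithinAt) (f' := f') (fun t ht => ?_) (fun t ht => ?_)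
    · exact (h1 t (interior_subset ht)).mono interior_subset
    · exact h2 t (interior_subset ht)
  have hRnn : ∀ n m t, 0 ≤ t → 0 ≤ R n m t := by
    intro n
    induction n with
    | zero => intro m t ht; simpa [hR] using hD m t ht
    | succ n ih =>
      intro m t ht
      rw [← hR0 n m]
      exact mono _ _ (hRd n m) (ih (m + 1)) self_mem_Ici ht ht
  -- Halving the argument gains `2⁻ⁿ`. At `s = 2t`, where the remainder is at most `D 0 (2t)`, this
  -- forces convergence.
  have hRs : ∀ n m s, 0 ≤ s → R n m (2⁻¹ * s) ≤ 2⁻¹ ^ n * R n m s := by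
    intro n
    induction n with
    | zero =>
      intro m s hs
      simpa [hR] using mono _ _ (hd m) (hD (m + 1)) (show 2⁻¹ * s ∈ Ici 0 by simpa) hs
        (by linarith)
    | succ n ih =>
      intro m s hs
      have := mono (fun s => 2⁻¹ ^ (n + 1) * R (n + 1) m s - R (n + 1) m (2⁻¹ * s))
        (fun s => 2⁻¹ ^ (n + 1) * R n (m + 1) s - R n (m + 1) (2⁻¹ * s) * (2⁻¹ * 1))
        (fun s hs => ((hRd n m s hs).const_mul _).sub
          ((hRd n m (2⁻¹ * s) (by positivity)).comp s
            ((hasDerivWithinAt_id s _).const_mul 2⁻¹) (fun x hx => by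
              have hx : 0 ≤ x := hx
              show 0 ≤ 2⁻¹ * x
              positivity)))
        (fun s hs => by have := ih (m + 1) s hs; rw [pow_succ]; linarith)
        self_mem_Ici hs hs
      simp only [mul_zero, hR0, sub_zero] at this
      linarith
  rw [hasSum_iff_tendsto_nat_of_nonneg
    (fun n => mul_nonneg (by positivity) (hD n 0 le_rfl))]
  have hlim : Tendsto (fun n => R n 0 t) atTop (𝓝 0) := by
    have h2 : Tendsto (fun n : ℕ => (2⁻¹ : ℝ) ^ n * D 0 (2 * t)) atTop (𝓝 (0 * D 0 (2 * t))) :=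
      (tendsto_pow_atTop_nhds_zero_of_lt_one (by norm_num) (by norm_num)).mul_const _
    rw [zero_mul] at h2
    refine squeeze_zero (fun n => hRnn n 0 t ht) (fun n => ?_) h2
    have h3 := hRs n 0 (2 * t) (by positivity)
    rw [inv_mul_cancel_left₀ two_ne_zero] at h3
    refine h3.trans ?_
    gcongr
    refine sub_le_self _ (Finset.sum_nonneg fun j _ => mul_nonneg (by positivity) ?_)
    exact hD _ 0 le_rfl
  have := (tendsto_const_nhds (x := D 0 t)).sub hlim
  simpa [hR] using this

/-- The adjacency operator of the integer line. -/
def lineAdj (f : ℤ → ℝ) (k : ℤ) : ℝ := f (k + 1) + f (k - 1)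

theorem lineAdj_iterate_succ (f : ℤ → ℝ) (n : ℕ) (k : ℤ) :
    lineAdj^[n + 1] f k = lineAdj^[n] f (k + 1) + lineAdj^[n] f (k - 1) := by
  rw [Function.iterate_succ_apply']; rfl

theorem lineAdj_iterate_nonneg {f : ℤ → ℝ} (hf : ∀ k, 0 ≤ f k) (n : ℕ) :
    ∀ k, 0 ≤ lineAdj^[n] f k := by
  induction n with
  | zero => exact hf
  | succ n ih => intro k; rw [lineAdj_iterate_succ]; exact add_nonneg (ih _) (ih _)

theorem lineAdj_iterate_mono {f g : ℤ → ℝ} (hfg : ∀ k, f k ≤ g k) (n : ℕ) :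
    ∀ k, lineAdj^[n] f k ≤ lineAdj^[n] g k := by
  induction n with
  | zero => exact hfg
  | succ n ih => intro k; simp only [lineAdj_iterate_succ]; exact add_le_add (ih _) (ih _)

theorem lineAdj_iterate_const (M : ℝ) (n : ℕ) :
    ∀ k, lineAdj^[n] (fun _ => M) k = 2 ^ n * M := by
  induction n with
  | zero => simp
  | succ n ih => intro k; rw [lineAdj_iterate_succ, ih, ih]; ring

theorem lineAdj_iterate_periodic {f : ℤ → ℝ} {N : ℤ} (hf : Function.Periodic f N) (n : ℕ) :
    Function.Periodic (lineAdj^[n] f) N := by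
  induction n with
  | zero => exact hf
  | succ n ih =>
    intro k
    simp only [lineAdj_iterate_succ]
    rw [show k + N + 1 = k + 1 + N by ring, show k + N - 1 = k - 1 + N by ring, ih, ih]

theorem tendsto_lineAdj_iterate {ι : Type*} {l : Filter ι} {F : ι → ℤ → ℝ} {f : ℤ → ℝ}
    (h : ∀ k, Tendsto (fun i => F i k) l (𝓝 (f k))) (n : ℕ) :
    ∀ k, Tendsto (fun i => lineAdj^[n] (F i) k) l (𝓝 (lineAdj^[n] f k)) := by
  induction n with
  | zero => exact h
  | succ n ih => intro k; simp only [lineAdj_iterate_succ]; exact (ih _).add (ih _)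

/-- The exponential `exp (t * lineAdj) f`, as a power series. -/
noncomputable def lineFlow (f : ℤ → ℝ) (t : ℝ) (k : ℤ) : ℝ :=
  ∑' n : ℕ, t ^ n / n.factorial * lineAdj^[n] f k

/-- The time derivatives are the iterates of `lineAdj` on `z t`, all nonnegative, so a nonnegative
solution is determined by its initial data. -/
theorem hasSum_lineFlow_of_hasDerivWithinAt {z : ℝ → ℤ → ℝ} (hz : ∀ t, 0 ≤ t → ∀ k, 0 ≤ z t k)
    (hd : ∀ t, 0 ≤ t → ∀ k, HasDerivWithinAt (fun s => z s k) (lineAdj (z t) k) (Ici 0) t)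
    {t : ℝ} (ht : 0 ≤ t) (k : ℤ) :
    HasSum (fun n : ℕ => t ^ n / n.factorial * lineAdj^[n] (z 0) k) (z t k) := by
  refine hasSum_taylor_of_nonneg (D := fun n t => lineAdj^[n] (z t) k)
    (fun n t ht => lineAdj_iterate_nonneg (hz t ht) n k) (fun n => ?_) ht
  induction n generalizing k with
  | zero => intro t ht; exact hd t ht k
  | succ n ih =>
    intro t ht
    have e := fun s => lineAdj_iterate_succ (z s) n k
    rw [lineAdj_iterate_succ, funext e]
    exact (ih (k + 1) t ht).add (ih (k - 1) t ht)

theorem summable_lineFlow {f : ℤ → ℝ} (hf : ∀ k, 0 ≤ f k) {M : ℝ} (hM : ∀ k, f k ≤ M) (t : ℝ)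
    (k : ℤ) : Summable fun n : ℕ => t ^ n / n.factorial * lineAdj^[n] f k := by
  refine Summable.of_norm_bounded ((Real.summable_pow_div_factorial (2 * |t|)).mul_right M) ?_
  intro n
  have h := (lineAdj_iterate_mono hM n k).trans_eq (lineAdj_iterate_const M n k)
  rw [norm_mul, norm_div, norm_pow, Real.norm_natCast, Real.norm_eq_abs,
    Real.norm_of_nonneg (lineAdj_iterate_nonneg hf n k)]
  calc |t| ^ n / n.factorial * lineAdj^[n] f k ≤ |t| ^ n / n.factorial * (2 ^ n * M) := by gcongr
    _ = _ := by rw [mul_pow]; ring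

theorem hasDerivAt_tsum_pow_div_factorial {c : ℕ → ℝ} {M : ℝ} (hc : ∀ n, |c n| ≤ 2 ^ n * M)
    (t : ℝ) : HasDerivAt (fun t => ∑' n : ℕ, t ^ n / n.factorial * c n)
      (∑' n : ℕ, t ^ n / n.factorial * c (n + 1)) t := by
  have hM : 0 ≤ M := by simpa using (abs_nonneg _).trans (hc 0)
  set r := |t| + 1
  have hr : 0 < r := by positivity
  -- The factor `n` kills the term `n = 0`, where `n - 1` is truncated.
  set g' : ℕ → ℝ → ℝ := fun n t => n * t ^ (n - 1) / n.factorial * c n with hg'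
  have hs : ∀ n (t : ℝ), g' (n + 1) t = t ^ n / n.factorial * c (n + 1) := by
    intro n t
    simp only [hg', Nat.factorial_succ, add_tsub_cancel_right]
    push_cast
    have : (n.factorial : ℝ) ≠ 0 := by positivity
    field_simp
  have hsum : Summable fun n : ℕ => n * r ^ (n - 1) / n.factorial * (2 ^ n * M) := by
    rw [← summable_nat_add_iff 1]
    refine ((Real.summable_pow_div_factorial (2 * r)).mul_right (2 * M)).congr fun n => ?_
    simp only [Nat.factorial_succ, add_tsub_cancel_right]
    push_cast
    have : (n.factorial : ℝ) ≠ 0 := by positivity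
    field_simp
    ring_nf
  have hb : ∀ n, ∀ y ∈ Metric.ball (0 : ℝ) r, ‖g' n y‖ ≤ n * r ^ (n - 1) / n.factorial *
      (2 ^ n * M) := by
    intro n y hy
    have hy : |y| ≤ r := by simpa using (Metric.mem_ball.1 hy).le
    simp only [hg', norm_mul, norm_div, norm_pow, Real.norm_eq_abs, Nat.abs_cast]
    have := hc n
    gcongr
  have key := hasDerivAt_tsum_of_isPreconnected (g := fun n (t : ℝ) => t ^ n / n.factorial * c n)
    (g' := g') (y₀ := 0) (y := t) hsum Metric.isOpen_ball (convex_ball (0 : ℝ) r).isPreconnected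
    (fun n y _ => ((hasDerivAt_pow n y).div_const _).mul_const _) hb (by simpa using hr)
    (summable_of_ne_finset_zero (s := {0}) fun n hn => by
      simp [show n ≠ 0 by simpa using hn]) (by simp [r])
  refine key.congr_deriv ?_
  have hsg : Summable fun n => g' n t := by
    refine Summable.of_norm_bounded hsum fun n => hb n t (by simp [r])
  rw [hsg.tsum_eq_zero_add]
  simp only [hs]
  simp [hg']

theorem hasDerivAt_lineFlow {f : ℤ → ℝ} (hf : ∀ k, 0 ≤ f k) {M : ℝ} (hM : ∀ k, f k ≤ M) (t : ℝ)
    (k : ℤ) : HasDerivAt (fun t => lineFlow f t k) (lineAdj (lineFlow f t) k) t := by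
  refine (hasDerivAt_tsum_pow_div_factorial (M := M) (fun n => ?_) t).congr_deriv ?_
  · rw [abs_of_nonneg (lineAdj_iterate_nonneg hf n k)]
    exact (lineAdj_iterate_mono hM n k).trans_eq (lineAdj_iterate_const M n k)
  · simp only [lineAdj_iterate_succ, mul_add]
    exact (summable_lineFlow hf hM t _).tsum_add (summable_lineFlow hf hM t _)

theorem lineFlow_pos {f : ℤ → ℝ} (hf : ∀ k, 0 < f k) {M : ℝ} (hM : ∀ k, f k ≤ M) {t : ℝ}
    (ht : 0 ≤ t) (k : ℤ) : 0 < lineFlow f t k := by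
  have hf' := fun k => (hf k).le
  refine (summable_lineFlow hf' hM t k).tsum_pos
    (fun n => mul_nonneg (by positivity) (lineAdj_iterate_nonneg hf' n k)) 0 ?_
  simpa using hf k

theorem lineFlow_periodic {f : ℤ → ℝ} {N : ℤ} (hf : Function.Periodic f N) (t : ℝ) :
    Function.Periodic (lineFlow f t) N := by
  intro k
  simp only [lineFlow, (lineAdj_iterate_periodic hf _) k]

/-- The majorant `g` may be unbounded; only its series at the one point `k` has to converge. -/
theorem tendsto_lineFlow {ι : Type*} {l : Filter ι} {F : ι → ℤ → ℝ} {f g : ℤ → ℝ}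
    (h : ∀ k, Tendsto (fun i => F i k) l (𝓝 (f k))) (h0 : ∀ i k, 0 ≤ F i k)
    (hg : ∀ i k, F i k ≤ g k) {t : ℝ} (ht : 0 ≤ t) (k : ℤ)
    (hs : Summable fun n : ℕ => t ^ n / n.factorial * lineAdj^[n] g k) :
    Tendsto (fun i => lineFlow (F i) t k) l (𝓝 (lineFlow f t k)) := by
  refine tendsto_tsum_of_dominated_convergence hs
    (fun n => (tendsto_lineAdj_iterate h n k).const_mul _) (Eventually.of_forall fun i n => ?_)
  rw [Real.norm_of_nonneg (mul_nonneg (by positivity) (lineAdj_iterate_nonneg (h0 i) n k))]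
  gcongr
  exact lineAdj_iterate_mono (hg i) n k

/-! ### The maximum principle for periodic solutions. -/

/-- Here `x` is the value at a maximum of `G`, `p, m` are its neighbours and `pp, mm` the next ones;
the cubic hypotheses say that `G` is no larger at the neighbours. They bound `pp` and `mm` below,
and AM-GM for `p, m` does the rest. -/
theorem second_log_deriv_le {x p m pp mm : ℝ} (hx : 0 < x) (hp : 0 < p) (hm : 0 < m)
    (hpp : p ^ 3 * m ≤ x ^ 3 * pp) (hmm : m ^ 3 * p ≤ x ^ 3 * mm) :
    2 * ((p + m) / x) - (pp + x) / p - (x + mm) / m ≤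
      -ricciFlatCD 2 1 (2 * Real.log x - Real.log p - Real.log m) := by
  set r := Real.exp ((2 * Real.log x - Real.log p - Real.log m) / 2) with hr
  have hr0 : 0 < r := Real.exp_pos _
  have hr2 : Real.exp (2 * Real.log x - Real.log p - Real.log m) = x ^ 2 / (p * m) := by
    rw [Real.exp_sub, Real.exp_sub, two_mul, Real.exp_add, Real.exp_log hx, Real.exp_log hp,
      Real.exp_log hm]
    field_simp
  have hr3 : r ^ 2 = x ^ 2 / (p * m) := by
    rw [← hr2, hr, ← Real.exp_nat_mul]; congr 1; push_cast; ring
  rw [ricciFlatCD_two, one_mul, ← hr, Real.exp_neg, hr2]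
  have h1 : r ≤ (p + m) * x / (2 * (p * m)) := by
    refine le_of_sq_le_sq ?_ (by positivity)
    rw [hr3, div_pow, div_le_div_iff₀ (by positivity) (by positivity)]
    nlinarith [mul_nonneg (mul_pos (mul_pos hx hx) (mul_pos hp hm)).le (sq_nonneg (p - m))]
  have h2 : p ^ 2 * m / x ^ 3 ≤ pp / p := by
    rw [div_le_div_iff₀ (by positivity) hp]; nlinarith
  have h3 : m ^ 2 * p / x ^ 3 ≤ mm / m := by
    rw [div_le_div_iff₀ (by positivity) hm]; nlinarith
  calc 2 * ((p + m) / x) - (pp + x) / p - (x + mm) / m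
      = 2 * ((p + m) / x) - x / p - x / m - pp / p - mm / m := by ring
    _ ≤ 2 * ((p + m) / x) - x / p - x / m - p ^ 2 * m / x ^ 3 - m ^ 2 * p / x ^ 3 := by linarith
    _ = -(2 / 1 ^ 2 * ((p + m) * x / (2 * (p * m)) * (1 - (x ^ 2 / (p * m))⁻¹) ^ 2)) := by
      field_simp; ring
    _ ≤ _ := by gcongr

/-- This makes `lam * φ` a strict supersolution of the relaxation equation. -/
theorem IsCDFunction.mul_lt {F : ℝ → ℝ} (hF : IsCDFunction F) {lam a : ℝ} (hl : 1 < lam)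
    (ha : 0 < a) : lam * F a < F (lam * a) := by
  have h := hF.strictMonoOn (show a ∈ Ioi 0 from ha)
    (show lam * a ∈ Ioi 0 from mul_pos (by linarith) ha) (by nlinarith)
  have h : F a / a < F (lam * a) / (lam * a) := h
  rw [div_lt_div_iff₀ ha (by positivity)] at h
  nlinarith

/-- The Li-Yau inequality for spatially periodic positive solutions, up to a factor `lam > 1`. -/
theorem liYau_periodic_lt {φ : ℝ → ℝ} (hφ : IsRelaxationFunction (ricciFlatCD 2 1) φ)
    {z : ℝ → ℤ → ℝ} {N : ℕ} (hN : 0 < N) (hper : ∀ t, Function.Periodic (z t) N)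
    (hz : ∀ t, 0 ≤ t → ∀ k, 0 < z t k)
    (hd : ∀ t, 0 ≤ t → ∀ k, HasDerivAt (fun s => z s k) (lineAdj (z t) k) t)
    {lam : ℝ} (hl : 1 < lam) {t : ℝ} (ht : 0 < t) (k : ℤ) :
    2 * Real.log (z t k) - Real.log (z t (k + 1)) - Real.log (z t (k - 1)) < lam * φ t := by
  set G : ℝ → ℤ → ℝ := fun t k =>
    2 * Real.log (z t k) - Real.log (z t (k + 1)) - Real.log (z t (k - 1)) with hG
  have hGd : ∀ t, 0 ≤ t → ∀ k, HasDerivAt (fun s => G s k) (2 * (lineAdj (z t) k / z t k) -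
      lineAdj (z t) (k + 1) / z t (k + 1) - lineAdj (z t) (k - 1) / z t (k - 1)) t := by
    intro t ht k
    have h := fun k => (hd t ht k).log (hz t ht k).ne'
    exact (((h k).const_mul 2).sub (h (k + 1))).sub (h (k - 1))
  have hGper : ∀ t, Function.Periodic (G t) N := by
    intro t k
    simp only [hG]
    rw [show k + N + 1 = k + 1 + N by ring, show k + N - 1 = k - 1 + N by ring,
      hper t k, hper t (k + 1), hper t (k - 1)]
  have hred : ∀ k : ℤ, ∃ j ∈ Finset.range N, ∀ t, G t k = G t j := by
    intro k
    have hN' : (0 : ℤ) < N := by exact_mod_cast hN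
    have h0 := Int.emod_nonneg k hN'.ne'
    have h1 := Int.emod_lt_of_pos k hN'
    refine ⟨(k % N).toNat, by rw [Finset.mem_range]; omega, fun t => ?_⟩
    rw [Int.toNat_of_nonneg h0, ← (hGper t).int_mul (k / N) (k % N)]
    congr 1
    have := Int.emod_add_mul_ediv k N
    simp only [Int.cast_id]
    linarith [mul_comm (k / (N : ℤ)) N]
  set ψ : ℝ → ℝ := fun t => lam * φ t with hψ
  have hψd : ∀ t, 0 < t → HasDerivAt ψ (lam * -ricciFlatCD 2 1 (φ t)) t := fun t ht =>
    (hφ.hasDerivAt t ht).const_mul lam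
  have hψtop : Tendsto ψ (𝓝[>] 0) atTop := hφ.tendsto_zero.const_mul_atTop (by linarith)
  -- `G` stays bounded near time 0 while `ψ` blows up.
  have hnear : ∀ᶠ s in 𝓝[>] (0 : ℝ), ∀ j ∈ Finset.range N, G s j < ψ s := by
    rw [Finset.eventually_all]
    intro j _
    have hc : Tendsto (fun s => G s j) (𝓝[>] 0) (𝓝 (G 0 j)) :=
      (hGd 0 le_rfl j).continuousAt.tendsto.mono_left nhdsWithin_le_nhds
    filter_upwards [hc.eventually_lt_const (lt_add_one _),
      hψtop.eventually_gt_atTop (G 0 j + 1)] with s h1 h2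
    exact h1.trans h2
  obtain ⟨ε, hε, hεG⟩ := mem_nhdsGT_iff_exists_Ioo_subset.1 hnear
  have hε : 0 < ε := hε
  by_contra! hcon
  -- Times at which `G` has reached `ψ`. Staying away from 0 makes the set compact, so a first such
  -- time exists.
  set S : Set ℝ := ⋃ j ∈ Finset.range N, {s ∈ Icc (min (ε / 2) t) t | ψ s ≤ G s j} with hS
  have hpos : 0 < min (ε / 2) t := lt_min (half_pos hε) ht
  have hScpt : IsCompact S := by
    refine (Finset.range N).isCompact_biUnion fun j _ => ?_
    refine isCompact_Icc.of_isClosed_subset ?_ (sep_subset _ _)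
    refine isClosed_Icc.isClosed_le (fun s hs => ?_) (fun s hs => ?_)
    · exact (hψd s (hpos.trans_le hs.1)).continuousAt.continuousWithinAt
    · exact (hGd s (hpos.trans_le hs.1).le j).continuousAt.continuousWithinAt
  have hSne : S.Nonempty := by
    obtain ⟨j, hj, hjG⟩ := hred k
    refine ⟨t, mem_biUnion hj ⟨⟨min_le_right _ _, le_rfl⟩, ?_⟩⟩
    rw [← hjG]; exact hcon
  obtain ⟨t₀, ht₀, hmin⟩ := hScpt.exists_isLeast hSne
  simp only [hS, mem_iUnion] at ht₀
  obtain ⟨j, hj, ⟨ht₀l, ht₀t⟩, hjG⟩ := ht₀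
  have ht₀pos : 0 < t₀ := hpos.trans_le ht₀l
  have hbefore : ∀ s, 0 < s → s < t₀ → ∀ i : ℤ, G s i < ψ s := by
    intro s hs hst i
    obtain ⟨i', hi', hiG⟩ := hred i
    rw [hiG]
    rcases lt_or_ge s (min (ε / 2) t) with h | h
    · exact hεG ⟨hs, by linarith [h.trans_le (min_le_left _ _)]⟩ i' hi'
    · by_contra! hc
      exact absurd (hmin (mem_biUnion hi' ⟨⟨h, hst.le.trans ht₀t⟩, hc⟩)) (not_le.2 hst)
  have hle : ∀ i : ℤ, G t₀ i ≤ ψ t₀ := by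
    intro i
    refine le_of_tendsto_of_tendsto
      ((hGd t₀ ht₀pos.le i).continuousAt.tendsto.mono_left (nhdsWithin_le_nhds (s := Iio t₀)))
      ((hψd t₀ ht₀pos).continuousAt.tendsto.mono_left nhdsWithin_le_nhds) ?_
    filter_upwards [Ioo_mem_nhdsLT ht₀pos] with s hs
    exact (hbefore s hs.1 hs.2 i).le
  have heq : G t₀ j = ψ t₀ := le_antisymm (hle j) hjG
  have hzp := hz t₀ ht₀pos.le
  -- With `l` a neighbour of `i`, `i - (l - i)` is the opposite neighbour and `l + (l - i)` the
  -- point beyond `l`; this covers both sides at once.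
  have cube : ∀ i l : ℤ, l = i + 1 ∨ l = i - 1 → G t₀ l ≤ G t₀ i →
      z t₀ l ^ 3 * z t₀ (i - (l - i)) ≤ z t₀ i ^ 3 * z t₀ (l + (l - i)) := by
    intro i l hil h
    rw [← Real.log_le_log_iff (mul_pos (pow_pos (hzp _) _) (hzp _))
      (mul_pos (pow_pos (hzp _) _) (hzp _)), Real.log_mul (pow_pos (hzp _) _).ne' (hzp _).ne',
      Real.log_mul (pow_pos (hzp _) _).ne' (hzp _).ne', Real.log_pow, Real.log_pow]
    simp only [hG] at h
    push_cast
    rcases hil with rfl | rfl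
    · rw [show i + 1 - 1 = i by ring] at h
      rw [show i - (i + 1 - i) = i - 1 by ring, show i + 1 + (i + 1 - i) = i + 1 + 1 by ring]
      linarith
    · rw [show i - 1 + 1 = i by ring] at h
      rw [show i - (i - 1 - i) = i + 1 by ring, show i - 1 + (i - 1 - i) = i - 1 - 1 by ring]
      linarith
  have hder : 2 * (lineAdj (z t₀) j / z t₀ j) - lineAdj (z t₀) (j + 1) / z t₀ (j + 1) -
      lineAdj (z t₀) (j - 1) / z t₀ (j - 1) ≤ -ricciFlatCD 2 1 (ψ t₀) := by
    have c1 := cube j (j + 1) (Or.inl rfl) ((hle _).trans heq.ge)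
    have c2 := cube j (j - 1) (Or.inr rfl) ((hle _).trans heq.ge)
    rw [show (j : ℤ) - (j + 1 - j) = j - 1 by ring,
      show (j : ℤ) + 1 + (j + 1 - j) = j + 1 + 1 by ring] at c1
    rw [show (j : ℤ) - (j - 1 - j) = j + 1 by ring,
      show (j : ℤ) - 1 + (j - 1 - j) = j - 1 - 1 by ring] at c2
    rw [← heq]
    have := second_log_deriv_le (hzp j) (hzp (j + 1)) (hzp (j - 1)) c1 c2
    simpa only [lineAdj, add_sub_cancel_right, sub_add_cancel] using this
  -- `G - ψ` vanishes at `t₀` and is negative before, so its left slopes are positive, yet its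
  -- derivative is negative.
  have hslope := ((hGd t₀ ht₀pos.le j).sub (hψd t₀ ht₀pos)).hasDerivWithinAt (s := Iio t₀)
  rw [hasDerivWithinAt_iff_tendsto_slope' self_notMem_Iio] at hslope
  have hcd := hφ.isCDFunction.mul_lt hl (hφ.pos t₀ ht₀pos)
  have hneg : 2 * (lineAdj (z t₀) j / z t₀ j) - lineAdj (z t₀) (j + 1) / z t₀ (j + 1) -
      lineAdj (z t₀) (j - 1) / z t₀ (j - 1) - lam * -ricciFlatCD 2 1 (φ t₀) < 0 := by
    simp only [hψ] at hder; linarith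
  obtain ⟨s, hs1, hs⟩ := ((hslope.eventually_lt_const hneg).and (Ioo_mem_nhdsLT ht₀pos)).exists
  rw [slope_def_field] at hs1
  simp only [Pi.sub_apply, heq, sub_self, sub_zero] at hs1
  have := div_pos_of_neg_of_neg (sub_neg.2 (hbefore s hs.1 hs.2 j)) (sub_neg.2 hs.2)
  linarith

/-! ### From periodic to arbitrary positive data, and to the grid. -/

theorem sq_le_exp_mul_iff {C x p m : ℝ} (hx : 0 < x) (hp : 0 < p) (hm : 0 < m) :
    x ^ 2 ≤ Real.exp C * (p * m) ↔ 2 * Real.log x - Real.log p - Real.log m ≤ C := by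
  rw [← Real.log_le_log_iff (by positivity) (by positivity), Real.log_pow,
    Real.log_mul (Real.exp_pos C).ne' (by positivity), Real.log_exp, Real.log_mul hp.ne' hm.ne']
  push_cast
  constructor <;> intro h <;> linarith

theorem lineFlow_sq_le_of_periodic {φ : ℝ → ℝ} (hφ : IsRelaxationFunction (ricciFlatCD 2 1) φ)
    {f : ℤ → ℝ} {N : ℕ} (hN : 0 < N) (hper : Function.Periodic f N) (hf : ∀ k, 0 < f k)
    {M : ℝ} (hM : ∀ k, f k ≤ M) {t : ℝ} (ht : 0 < t) (k : ℤ) :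
    lineFlow f t k ^ 2 ≤ Real.exp (φ t) * (lineFlow f t (k + 1) * lineFlow f t (k - 1)) := by
  have hp := fun t ht k => lineFlow_pos hf hM (t := t) ht k
  rw [sq_le_exp_mul_iff (hp t ht.le k) (hp t ht.le _) (hp t ht.le _)]
  -- If the bound failed, `lam = G / φ > 1` would give `G < G`.
  by_contra! h
  have hφt := hφ.pos t ht
  have := liYau_periodic_lt hφ hN (fun t => lineFlow_periodic hper t) hp
    (fun t _ k => hasDerivAt_lineFlow (fun k => (hf k).le) hM t k)
    ((one_lt_div hφt).2 h) ht k
  rw [div_mul_cancel₀ _ hφt.ne'] at this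
  exact lt_irrefl _ this

theorem lineFlow_sq_le_of_bounded {φ : ℝ → ℝ} (hφ : IsRelaxationFunction (ricciFlatCD 2 1) φ)
    {f : ℤ → ℝ} (hf : ∀ k, 0 < f k) {M : ℝ} (hM : ∀ k, f k ≤ M) {t : ℝ} (ht : 0 < t) (k : ℤ) :
    lineFlow f t k ^ 2 ≤ Real.exp (φ t) * (lineFlow f t (k + 1) * lineFlow f t (k - 1)) := by
  -- Periodic extension from a window centred at 0, so that each fixed `k` eventually lies in it.
  set F : ℕ → ℤ → ℝ := fun N k => f (k.bmod (N + 1)) with hF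
  have hpt : ∀ k, Tendsto (fun N => F N k) atTop (𝓝 (f k)) := by
    intro k
    refine tendsto_const_nhds.congr' ?_
    filter_upwards [eventually_ge_atTop (2 * k.natAbs + 2)] with N hN
    simp only [hF]
    rw [Int.bmod_eq_of_le (by omega) (by omega)]
  have hlim : ∀ k, Tendsto (fun N => lineFlow (F N) t k) atTop (𝓝 (lineFlow f t k)) := fun k =>
    tendsto_lineFlow hpt (fun N k => (hf _).le) (fun N k => hM _) ht.le k
      (summable_lineFlow (f := fun _ => M) (fun _ => (hf 0).le.trans (hM 0)) (fun _ => le_rfl) t k)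
  refine le_of_tendsto_of_tendsto' ((hlim k).pow 2)
    (((hlim (k + 1)).mul (hlim (k - 1))).const_mul _) fun N => ?_
  refine lineFlow_sq_le_of_periodic hφ (N := N + 1) N.succ_pos (fun k => ?_) (fun k => hf _)
    (fun k => hM _) ht k
  simp only [Int.add_bmod_right]

/-- The Li-Yau inequality, in Harnack form, for positive solutions of `z' = lineAdj z`. -/
theorem sq_le_exp_mul_of_hasDerivWithinAt {φ : ℝ → ℝ}
    (hφ : IsRelaxationFunction (ricciFlatCD 2 1) φ) {z : ℝ → ℤ → ℝ}
    (hz : ∀ t, 0 ≤ t → ∀ k, 0 < z t k)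
    (hd : ∀ t, 0 ≤ t → ∀ k, HasDerivWithinAt (fun s => z s k) (lineAdj (z t) k) (Ici 0) t)
    {t : ℝ} (ht : 0 < t) (k : ℤ) :
    z t k ^ 2 ≤ Real.exp (φ t) * (z t (k + 1) * z t (k - 1)) := by
  have hsum := hasSum_lineFlow_of_hasDerivWithinAt (fun t ht k => (hz t ht k).le) hd ht.le
  have hflow : ∀ k, lineFlow (z 0) t k = z t k := fun k => (hsum k).tsum_eq
  have hz0 := hz 0 le_rfl
  -- Truncations lie below `z 0`, whose own convergent series is the majorant.
  set F : ℕ → ℤ → ℝ := fun M k => min (z 0 k) (M + 1) with hF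
  have hFpos : ∀ M k, 0 < F M k := fun M k => lt_min (hz0 k) (by positivity)
  have hpt : ∀ k, Tendsto (fun M => F M k) atTop (𝓝 (z 0 k)) := by
    intro k
    refine tendsto_const_nhds.congr' ?_
    filter_upwards [eventually_ge_atTop ⌈z 0 k⌉₊] with M hM
    have := Nat.ceil_le.1 hM
    exact (min_eq_left (by linarith)).symm
  have hlim : ∀ k, Tendsto (fun M => lineFlow (F M) t k) atTop (𝓝 (z t k)) := fun k => by
    rw [← hflow]
    exact tendsto_lineFlow hpt (fun M k => (hFpos M k).le) (fun M k => min_le_left _ _) ht.le k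
      (hsum k).summable
  exact le_of_tendsto_of_tendsto' ((hlim k).pow 2)
    (((hlim (k + 1)).mul (hlim (k - 1))).const_mul _) fun M =>
      lineFlow_sq_le_of_bounded hφ (hFpos M) (fun k => min_le_right _ _) ht k

theorem neg_gridLaplacian_log_le {φ : ℝ → ℝ} (hφ : IsRelaxationFunction (ricciFlatCD 2 1) φ)
    {τ : ℝ} (hτ : 0 < τ) {u : ℝ → Grid τ → ℝ} (hu : ∀ t, 0 ≤ t → ∀ x, 0 < u t x)
    (hsol : SolvesGridHeat τ u) {t : ℝ} (ht : 0 < t) (x : Grid τ) :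
    -gridLaplacian τ (fun y => Real.log (u t y)) x ≤ 1 / τ ^ 2 * φ (t / τ ^ 2) := by
  -- The exponential cancels the diagonal term `-2u`, and the time change absorbs `1/τ²`.
  set z : ℝ → ℤ → ℝ := fun s k => Real.exp (2 * s) * u (τ ^ 2 * s) (x + k • gridStep τ) with hzdef
  have hz : ∀ s, 0 ≤ s → ∀ k, 0 < z s k := fun s hs k =>
    mul_pos (Real.exp_pos _) (hu _ (by positivity) _)
  have hd : ∀ s, 0 ≤ s → ∀ k,
      HasDerivWithinAt (fun r => z r k) (lineAdj (z s) k) (Ici 0) s := by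
    intro s hs k
    have h1 : HasDerivWithinAt (fun r : ℝ => Real.exp (2 * r)) (Real.exp (2 * s) * (2 * 1))
        (Ici 0) s := ((hasDerivWithinAt_id s _).const_mul 2).exp
    have h2 := (hsol (τ ^ 2 * s) (by positivity) (x + k • gridStep τ)).comp s
      ((hasDerivWithinAt_id s (Ici 0)).const_mul (τ ^ 2)) (fun r hr => by
        have hr : 0 ≤ r := hr
        show 0 ≤ τ ^ 2 * r
        positivity)
    refine (h1.mul h2).congr_deriv ?_
    simp only [gridLaplacian, lineAdj, hzdef, add_smul, sub_smul, one_smul, add_assoc,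
      add_sub_assoc, Function.comp]
    field_simp
    ring
  have key := sq_le_exp_mul_of_hasDerivWithinAt hφ hz hd (t := t / τ ^ 2) (by positivity) 0
  have hs : 0 ≤ t / τ ^ 2 := by positivity
  rw [sq_le_exp_mul_iff (hz _ hs _) (hz _ hs _) (hz _ hs _)] at key
  have hlog : ∀ k, Real.log (z (t / τ ^ 2) k) =
      2 * (t / τ ^ 2) + Real.log (u t (x + k • gridStep τ)) := by
    intro k
    simp only [hzdef]
    rw [mul_div_cancel₀ t (by positivity : τ ^ 2 ≠ 0),
      Real.log_mul (Real.exp_pos _).ne' (hu t ht.le _).ne', Real.log_exp]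
  simp only [hlog, zero_add, zero_sub, zero_smul, one_smul, neg_smul, add_zero,
    ← sub_eq_add_neg] at key
  rw [gridLaplacian, ← mul_neg]
  gcongr
  linarith

/-- Li-Yau inequality on the grid `τℤ`. The relaxation function `φ` for `D = 2`, `μ₀ = 1` exists;
its rescaling `t ↦ τ⁻² φ(t / τ²)` is the relaxation function for `D = 2`, `μ₀ = τ²` (the vertex
measure for which the graph Laplacian on the grid is `Δ_τ`), and it bounds `-Δ_τ (log u)` for all
positive global solutions `u` of the heat equation on the grid. -/
theorem corollary4p10 :
    (∃ φ : ℝ → ℝ, IsRelaxationFunction (ricciFlatCD 2 1) φ) ∧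
    ∀ φ : ℝ → ℝ, IsRelaxationFunction (ricciFlatCD 2 1) φ →
      ∀ τ : ℝ, 0 < τ →
        IsRelaxationFunction (ricciFlatCD 2 (τ ^ 2)) (fun t => 1 / τ ^ 2 * φ (t / τ ^ 2)) ∧
        ∀ u : ℝ → Grid τ → ℝ,
          (∀ t, 0 ≤ t → ∀ x, 0 < u t x) → SolvesGridHeat τ u →
          ∀ t, 0 < t → ∀ x : Grid τ,
            -gridLaplacian τ (fun y => Real.log (u t y)) x ≤ 1 / τ ^ 2 * φ (t / τ ^ 2) := by
  refine ⟨exists_isRelaxationFunction, fun φ hφ τ hτ => ⟨hφ.rescale (by positivity), ?_⟩⟩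
  intro u hu hsol t ht x
  exact neg_gridLaplacian_log_le hφ hτ hu hsol ht x
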